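/- A spacetime on $\mathbb{R}^4$ is a smooth Lorentzian metric $g_{\mu\nu}$, of signature $(-,+,+,+)$, on $\mathbb{R}^4$; a vacuum solution is one whose Einstein tensor vanishes ($\Lambda=0$). Write $\widetilde g\simeq_{\mathrm{diff}} g$ if $g=\varphi^*\widetilde g$ for some smooth diffeomorphism $\varphi$ of $\mathbb{R}^4$, and give sets of spacetimes the $C^\infty$ compact-open topology and its Borel sets. A Polish $G$-space $X$ (a continuous action of a Polish group $G$ on a Polish space $X$) is generically ergodic if some orbit is dense and every orbit is meager. A family $\mathcal S$ of spacetimes is rich if there are a generically ergodic Polish $G$-space $X$ and a Borel reduction from its orbit equivalence relation $\simeq_G$ to $\simeq_{\mathrm{diff}}$ on $\mathcal S$, that is, a Borel map $r\colon X\to\mathcal S$ with $\alpha\simeq_G\beta\iff r(\alpha)\simeq_{\mathrm{diff}}r(\beta)$ for all $\alpha,\beta\in X$. **Theorem.** The vacuum solutions on $\mathbb{R}^4$ form a rich family. More precisely: 1. The Bernoulli shift $\mathbb{Z}\curvearrowright\{0,1\}^{\mathbb{Z}}$, $(k\cdot\alpha)(n)=\alpha(n-k)$, is a generically ergodic Polish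 $\mathbb{Z}$-space. 2. There are smooth functions $W\colon\mathbb{R}\to[0,1]$ which vanish outside $[0,1]$, take the value $1$ at exactly one point, that point being less than $1/2$, and whose graph is not symmetric about any vertical axis. 3. Let $W$ be any such function, and for $\alpha\in\{0,1\}^{\mathbb{Z}}$ put $W_\alpha(u)=2+W(u-\lfloor u\rfloor)$ if $\alpha(\lfloor u\rfloor)=1$ and $W_\alpha(u)=2-W(u-\lfloor u\rfloor)$ if $\alpha(\lfloor u\rfloor)=0$. Then the gravitational plane wave in Brinkmann form $$r(\alpha)=W_\alpha(u)\,xy\,du^2+du\,dv+dx^2+dy^2$$ is a vacuum solution on $\mathbb{R}^4$, the map $r$ is continuous, and it is a Borel reduction: $\beta=k\cdot\alpha$ for some $k\in\mathbb{Z}$ if and only if $r(\alpha)\simeq_{\mathrm{diff}}r(\beta)$. -/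

import Mathlib

open scoped ContDiff Manifold

noncomputable section

/-! ### Spacetimes on `ℝ⁴` -/

/-- The manifold `ℝ⁴`, with its global coordinates `x⁰, x¹, x², x³`. -/
abbrev R4 : Type := Fin 4 → ℝ

/-- The components `g_{μν}` of a bilinear form on `ℝ⁴`. -/
abbrev Components : Type := Fin 4 → Fin 4 → ℝ

/-- A bilinear form has Lorentzian signature `(-, +, +, +)`: it is symmetric, and in a suitable
basis (the columns of `P`) its matrix is `diag(-1, 1, 1, 1)`. -/
def IsLorentzian (A : Components) : Prop :=
  (∀ μ ν, A μ ν = A ν μ) ∧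
    ∃ P : Matrix (Fin 4) (Fin 4) ℝ, IsUnit P.det ∧
      P.transpose * Matrix.of A * P = Matrix.diagonal ![-1, 1, 1, 1]

/-- A smooth spacetime supported on `ℝ⁴`: a smooth field of Lorentzian metrics `g_{μν}`. -/
@[ext]
structure Spacetime where
  /-- The components `g_{μν}(x)`. -/
  metric : R4 → Components
  smooth : ContDiff ℝ ∞ metric
  lorentzian : ∀ x, IsLorentzian (metric x)

/-- The `n`-th derivative of the metric, as a continuous map on `ℝ⁴`. -/
def Spacetime.jet (n : ℕ) (g : Spacetime) :
    C(R4, ContinuousMultilinearMap ℝ (fun _ : Fin n => R4) Components) where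
  toFun := iteratedFDeriv ℝ n g.metric
  continuous_toFun := g.smooth.continuous_iteratedFDeriv (by exact_mod_cast le_top)

/-- The `C^∞` compact-open topology: uniform convergence on compact sets of the metric components
together with their derivatives of every order. -/
instance : TopologicalSpace Spacetime :=
  ⨅ n : ℕ, TopologicalSpace.induced (Spacetime.jet n) inferInstance

/-- The partial derivative `∂f/∂x^μ`. -/
def partialDeriv (μ : Fin 4) (f : R4 → ℝ) (x : R4) : ℝ :=
  fderiv ℝ f x (Pi.single μ 1)

/-- `g' ≃_diff g`: there is a smooth change of coordinates `φ` of `ℝ⁴` with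
`g_{μν}(x) = ∂φ^ρ/∂x^μ ∂φ^σ/∂x^ν g'_{ρσ}(φ x)`. -/
def DiffEquivalent (g' g : Spacetime) : Prop :=
  ∃ φ : Diffeomorph 𝓘(ℝ, R4) 𝓘(ℝ, R4) R4 R4 ∞, ∀ (x : R4) (μ ν : Fin 4),
    g.metric x μ ν = ∑ ρ, ∑ σ,
      partialDeriv μ (fun y => φ y ρ) x * partialDeriv ν (fun y => φ y σ) x *
        g'.metric (φ x) ρ σ

/-! ### Curvature and the vacuum equation -/

namespace Spacetime

variable (g : Spacetime)

/-- The inverse metric `g^{μν}`. -/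
def inverse (x : R4) (μ ν : Fin 4) : ℝ :=
  (Matrix.of (g.metric x))⁻¹ μ ν

/-- The Christoffel symbols `Γ^l_{μν}` of the Levi-Civita connection. -/
def christoffel (l μ ν : Fin 4) (x : R4) : ℝ :=
  (1 / 2) * ∑ s, g.inverse x l s *
    (partialDeriv μ (fun y => g.metric y ν s) x + partialDeriv ν (fun y => g.metric y μ s) x
      - partialDeriv s (fun y => g.metric y μ ν) x)

/-- The Ricci tensor
`R_{μν} = ∂_l Γ^l_{μν} - ∂_ν Γ^l_{lμ} + Γ^l_{ls} Γ^s_{μν} - Γ^l_{νs} Γ^s_{lμ}`. -/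
def ricci (μ ν : Fin 4) (x : R4) : ℝ :=
  ∑ l, (partialDeriv l (g.christoffel l μ ν) x - partialDeriv ν (g.christoffel l l μ) x)
    + ∑ l, ∑ s, (g.christoffel l l s x * g.christoffel s μ ν x
      - g.christoffel l ν s x * g.christoffel s l μ x)

/-- The scalar curvature `R = g^{μν} R_{μν}`. -/
def scalarCurvature (x : R4) : ℝ :=
  ∑ μ, ∑ ν, g.inverse x μ ν * g.ricci μ ν x

/-- The Einstein tensor `G_{μν} = R_{μν} - R g_{μν} / 2`. -/
def einstein (μ ν : Fin 4) (x : R4) : ℝ :=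
  g.ricci μ ν x - (1 / 2) * g.scalarCurvature x * g.metric x μ ν

end Spacetime

/-- The vacuum solutions on `ℝ⁴`: the spacetimes that satisfy Einstein's equation with vanishing
stress-energy tensor and vanishing cosmological constant. -/
def vacuumSolutions : Set Spacetime :=
  {g | ∀ x μ ν, g.einstein μ ν x = 0}

/-! ### Generic ergodicity and rich families -/

/-- `G` is a Polish group that acts continuously on the Polish space `X`. -/
structure IsPolishGSpace (G X : Type) [Group G] [TopologicalSpace G] [TopologicalSpace X]
    [MulAction G X] : Prop where
  topologicalGroup : IsTopologicalGroup G
  polishGroup : PolishSpace G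
  polishSpace : PolishSpace X
  continuous_smul : ContinuousSMul G X

/-- A Polish `G`-space is generically ergodic if some orbit is dense and every orbit is meager. -/
structure IsGenericallyErgodic (G X : Type) [Group G] [TopologicalSpace G] [TopologicalSpace X]
    [MulAction G X] : Prop extends IsPolishGSpace G X where
  exists_dense_orbit : ∃ x : X, Dense (MulAction.orbit G x)
  meager_orbit : ∀ x : X, IsMeagre (MulAction.orbit G x)

/-- `r` is a Borel reduction of the orbit equivalence relation of `G` on `X` to `≃_diff` on the
family `S` of spacetimes, which carries the `C^∞` compact-open topology. -/
structure IsBorelReduction (G : Type) {X : Type} [Group G] [TopologicalSpace X] [MulAction G X]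
    {S : Set Spacetime} (r : X → S) : Prop where
  borel : @Measurable X S (borel X) (borel S) r
  reduces : ∀ α β : X, MulAction.orbit G α = MulAction.orbit G β ↔
    DiffEquivalent (r α : Spacetime) (r β : Spacetime)

/-- A family of spacetimes is rich if the orbit equivalence relation of some generically ergodic
Polish `G`-space is Borel reducible to `≃_diff` on it. (A Polish space has at most continuum many
points, so nothing is lost by taking `G` and `X` in `Type`.) -/
def IsRich (S : Set Spacetime) : Prop :=
  ∃ (G X : Type) (_ : Group G) (_ : TopologicalSpace G) (_ : TopologicalSpace X)
    (_ : MulAction G X),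
    IsGenericallyErgodic G X ∧ ∃ r : X → S, IsBorelReduction G r

/-! ### The Bernoulli shift -/

/-- The space `{0,1}^ℤ`, with the product topology. -/
def BernoulliSpace : Type := ℤ → Bool

instance : TopologicalSpace BernoulliSpace := inferInstanceAs (TopologicalSpace (ℤ → Bool))

/-- The shift action of `ℤ` (written multiplicatively): `(k · α)(n) = α(n - k)`. -/
instance : MulAction (Multiplicative ℤ) BernoulliSpace where
  smul k α := fun n => α (n - k.toAdd)
  one_smul α := by
    funext n
    change α (n - 0) = α n
    rw [sub_zero]
  mul_smul k l α := by
    funext n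
    change α (n - (k.toAdd + l.toAdd)) = α (n - k.toAdd - l.toAdd)
    rw [sub_sub]

/-! ### The plane waves -/

/-- The plane wave in Brinkmann form `H du² + du dv + dx² + dy²` with `H(u,x,y) = w(u) x y`,
in the coordinates `(x⁰, x¹, x², x³) = (u, v, x, y)`. -/
def planeWave (w : ℝ → ℝ) (p : R4) : Components :=
  ![![w (p 0) * p 2 * p 3, 1 / 2, 0, 0],
    ![1 / 2, 0, 0, 0],
    ![0, 0, 1, 0],
    ![0, 0, 0, 1]]

/-- A smooth bell curve `[0,1] → [0,1]` which vanishes to infinite order at both end points (that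
is, a smooth function on `ℝ` once it is extended by zero), takes the value `1` at exactly one point,
which lies to the left of `1/2`, and is not symmetric about any vertical axis. -/
structure IsBellCurve (W : ℝ → ℝ) : Prop where
  smooth : ContDiff ℝ ∞ W
  eq_zero : ∀ x, x ∉ Set.Icc (0 : ℝ) 1 → W x = 0
  mem_Icc : ∀ x, W x ∈ Set.Icc (0 : ℝ) 1
  peak : ∃ x₀ < (1 / 2 : ℝ), W x₀ = 1 ∧ ∀ x, W x = 1 → x = x₀
  asymmetric : ∀ c : ℝ, ∃ t : ℝ, W (c + t) ≠ W (c - t)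

/-- The function `W_α`: on `[n, n+1)` it is `2 + W(u - n)` if `α(n) = 1` and `2 - W(u - n)` if
`α(n) = 0`. -/
def pulseTrain (W : ℝ → ℝ) (α : BernoulliSpace) (u : ℝ) : ℝ :=
  if α ⌊u⌋ = true then 2 + W (u - ⌊u⌋) else 2 - W (u - ⌊u⌋)

end

/-! Vacuum holds because `w(u) x y` is harmonic in the transverse variables. The shift on `{0,1}^ℤ`
becomes translation of `u`, which is an isometry; the content is the converse.

Let an isometry `(f, V, P, Q)` pull the wave with profile `w₂` back to the wave with profile `w₁`.
The transformation law of the Christoffel symbols (`hessian_of_isometry_planeWave`) makes `df`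
parallel. Since `w₁` has no zero, `du` is the only parallel gradient up to a factor, so `f = a u +
b` (`exists_affine_of_parallel`). Integrability of the Hessian equations of `P` and `Q` then gives
`w₁(u)² = (a² w₂(a u + b))²`, and positivity removes the squares (`profile_eq_of_diffEquivalent`).

For pulse trains, the ratio of maximum to minimum forces `a² = 1`. The unique peak of each pulse
aligns the integer cells, so `a = 1` gives a shift. A reflection `a = -1` would make `W` symmetric
unless the sequence is constant (`mem_orbit_of_pulseTrain_eq`).

Generic ergodicity of the shift is a Baire category argument together with the countability of
orbits. -/

/-! ### Partial derivatives -/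

section PartialDeriv

variable {f g : R4 → ℝ} {x : R4} {μ ν : Fin 4}

theorem partialDeriv_const (c : ℝ) : partialDeriv μ (fun _ => c) x = 0 := by
  simp [partialDeriv]

theorem partialDeriv_add (hf : DifferentiableAt ℝ f x) (hg : DifferentiableAt ℝ g x) :
    partialDeriv μ (fun y => f y + g y) x = partialDeriv μ f x + partialDeriv μ g x := by
  simp [partialDeriv, fderiv_fun_add hf hg]

theorem partialDeriv_sub (hf : DifferentiableAt ℝ f x) (hg : DifferentiableAt ℝ g x) :
    partialDeriv μ (fun y => f y - g y) x = partialDeriv μ f x - partialDeriv μ g x := by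
  simp [partialDeriv, fderiv_fun_sub hf hg]

theorem partialDeriv_mul (hf : DifferentiableAt ℝ f x) (hg : DifferentiableAt ℝ g x) :
    partialDeriv μ (fun y => f y * g y) x =
      partialDeriv μ f x * g x + f x * partialDeriv μ g x := by
  simp [partialDeriv, fderiv_fun_mul hf hg]
  ring

theorem partialDeriv_const_mul (c : ℝ) (hf : DifferentiableAt ℝ f x) :
    partialDeriv μ (fun y => c * f y) x = c * partialDeriv μ f x := by
  simp [partialDeriv, fderiv_const_mul hf]

theorem partialDeriv_coord : partialDeriv μ (fun y => y ν) x = if ν = μ then 1 else 0 := by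
  have h : HasFDerivAt (fun y : R4 => y ν) (ContinuousLinearMap.proj (R := ℝ) ν) x :=
    hasFDerivAt_apply ν x
  simp [partialDeriv, h.fderiv, Pi.single_apply]

theorem partialDeriv_comp {w : ℝ → ℝ} (hw : DifferentiableAt ℝ w (f x))
    (hf : DifferentiableAt ℝ f x) :
    partialDeriv μ (fun y => w (f y)) x = deriv w (f x) * partialDeriv μ f x := by
  have h := (hw.hasDerivAt.comp_hasFDerivAt x hf.hasFDerivAt).fderiv
  simp only [Function.comp_def] at h
  simp [partialDeriv, h]

/-- No differentiability is needed: where it fails, `fderiv` is zero by convention. -/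
theorem partialDeriv_eq_zero_of_translate (h : ∀ t : ℝ, f (x + t • Pi.single μ 1) = f x) :
    partialDeriv μ f x = 0 := by
  by_cases hf : DifferentiableAt ℝ f x
  · rw [partialDeriv, ← hf.lineDeriv_eq_fderiv, lineDeriv]
    simp [h]
  · simp [partialDeriv, fderiv_zero_of_not_differentiableAt hf]

theorem ContDiff.partialDeriv (hf : ContDiff ℝ ∞ f) (μ : Fin 4) :
    ContDiff ℝ ∞ (partialDeriv μ f) :=
  (hf.fderiv_right (m := ∞) (by norm_num)).clm_apply contDiff_const

theorem ContDiff.differentiableAt_infty (hf : ContDiff ℝ ∞ f) : DifferentiableAt ℝ f x :=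
  (hf.differentiable (by norm_num)).differentiableAt

theorem partialDeriv_comm (hf : ContDiff ℝ ∞ f) (μ ν : Fin 4) (x : R4) :
    partialDeriv μ (partialDeriv ν f) x = partialDeriv ν (partialDeriv μ f) x := by
  have h2 : DifferentiableAt ℝ (fderiv ℝ f) x :=
    ((hf.fderiv_right (m := ∞) (by norm_num)).differentiable (by norm_num)).differentiableAt
  have key : ∀ a b : Fin 4, partialDeriv a (partialDeriv b f) x =
      fderiv ℝ (fderiv ℝ f) x (Pi.single a 1) (Pi.single b 1) := by
    intro a b
    have := fderiv_clm_apply h2 (differentiableAt_const (Pi.single b (1 : ℝ)))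
    simp only [partialDeriv]
    change fderiv ℝ (fun y => fderiv ℝ f y (Pi.single b 1)) x _ = _
    rw [this]
    simp
  rw [key, key]
  exact (hf.contDiffAt.isSymmSndFDerivAt (by simpa using ENat.LEInfty.out)).eq _ _

theorem fderiv_apply_eq_sum_partialDeriv (v : R4) :
    fderiv ℝ f x v = ∑ μ, v μ * partialDeriv μ f x := by
  conv_lhs => rw [pi_eq_sum_univ' v]
  simp only [map_sum, map_smul, smul_eq_mul, partialDeriv]

theorem eq_of_partialDeriv_eq_zero (hf : ContDiff ℝ ∞ f)
    (h : ∀ μ x, partialDeriv μ f x = 0) (x y : R4) : f x = f y := by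
  refine is_const_of_fderiv_eq_zero (𝕜 := ℝ) (hf.differentiable (by norm_num)) (fun z => ?_) x y
  ext v
  simp [fderiv_apply_eq_sum_partialDeriv, h]

end PartialDeriv

/-! ### Plane waves -/

section PlaneWave

variable {w : ℝ → ℝ}

/-- The Brinkmann profile `H(u,x,y) = w(u) x y`. -/
noncomputable def brinkmannProfile (w : ℝ → ℝ) (p : R4) : ℝ := w (p 0) * p 2 * p 3

theorem contDiff_brinkmannProfile (hw : ContDiff ℝ ∞ w) : ContDiff ℝ ∞ (brinkmannProfile w) := by
  unfold brinkmannProfile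
  fun_prop

theorem partialDeriv_brinkmannProfile (hw : ContDiff ℝ ∞ w) (μ : Fin 4) (x : R4) :
    partialDeriv μ (brinkmannProfile w) x =
      ![deriv w (x 0) * x 2 * x 3, 0, w (x 0) * x 3, w (x 0) * x 2] μ := by
  have hw' : Differentiable ℝ w := hw.differentiable (by norm_num)
  have h := hw' (x 0)
  unfold brinkmannProfile
  rw [partialDeriv_mul (by fun_prop) (by fun_prop), partialDeriv_mul (by fun_prop) (by fun_prop),
    partialDeriv_comp h (by fun_prop)]
  simp only [partialDeriv_coord]
  fin_cases μ <;> simp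

theorem planeWave_eq (p : R4) : planeWave w p =
    ![![brinkmannProfile w p, 1 / 2, 0, 0], ![1 / 2, 0, 0, 0], ![0, 0, 1, 0], ![0, 0, 0, 1]] :=
  rfl

theorem contDiff_planeWave (hw : ContDiff ℝ ∞ w) : ContDiff ℝ ∞ (planeWave w) := by
  have := contDiff_brinkmannProfile hw
  refine contDiff_pi' fun μ => contDiff_pi' fun ν => ?_
  simp only [planeWave_eq]
  fin_cases μ <;> fin_cases ν <;> simp <;> fun_prop

theorem isLorentzian_planeWave (p : R4) : IsLorentzian (planeWave w p) := by
  refine ⟨fun μ ν => by fin_cases μ <;> fin_cases ν <;> rfl,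
    -- The vector `∂_u + c ∂_v` has square `H + c`; `c = -1 - H` and `c = 1 - H` give orthogonal
    -- vectors of squares `-1` and `1`.
    !![1, 1, 0, 0; -1 - brinkmannProfile w p, 1 - brinkmannProfile w p, 0, 0;
      0, 0, 1, 0; 0, 0, 0, 1], ?_, ?_⟩
  · rw [isUnit_iff_ne_zero]
    simp [Matrix.det_succ_row_zero, Fin.sum_univ_succ, Fin.succAbove]
    ring_nf
    norm_num
  · rw [planeWave_eq]
    ext i j
    fin_cases i <;> fin_cases j <;>
      simp [Matrix.mul_apply, Fin.sum_univ_succ, Matrix.transpose_apply] <;> ring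

/-- The plane wave `w(u) x y du² + du dv + dx² + dy²` as a spacetime. -/
noncomputable def planeWaveSpacetime (w : ℝ → ℝ) (hw : ContDiff ℝ ∞ w) : Spacetime where
  metric := planeWave w
  smooth := contDiff_planeWave hw
  lorentzian := isLorentzian_planeWave

theorem inverse_planeWaveSpacetime (hw : ContDiff ℝ ∞ w) (x : R4) (μ ν : Fin 4) :
    (planeWaveSpacetime w hw).inverse x μ ν =
      !![0, 2, 0, 0; 2, -4 * brinkmannProfile w x, 0, 0; 0, 0, 1, 0; 0, 0, 0, 1] μ ν := by
  unfold Spacetime.inverse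
  rw [Matrix.inv_eq_right_inv]
  change Matrix.of (planeWave w x) * _ = _
  rw [planeWave_eq]
  ext i j
  fin_cases i <;> fin_cases j <;>
    simp [Matrix.mul_apply, Fin.sum_univ_succ]
  ring

theorem partialDeriv_planeWave (κ μ ν : Fin 4) (x : R4) :
    partialDeriv κ (fun y => planeWave w y μ ν) x =
      if μ = 0 ∧ ν = 0 then partialDeriv κ (brinkmannProfile w) x else 0 := by
  simp only [planeWave_eq]
  fin_cases μ <;> fin_cases ν <;> simp [partialDeriv_const]

/-- The Christoffel symbols of the plane wave with profile `w(u) x y`. -/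
noncomputable def planeWaveChristoffel (w : ℝ → ℝ) (l μ ν : Fin 4) (x : R4) : ℝ :=
  ![0,
    if μ = 0 then
      if ν = 0 then deriv w (x 0) * x 2 * x 3 else
        ![0, 0, w (x 0) * x 3, w (x 0) * x 2] ν
    else if ν = 0 then ![0, 0, w (x 0) * x 3, w (x 0) * x 2] μ else 0,
    if μ = 0 ∧ ν = 0 then -(1 / 2) * (w (x 0) * x 3) else 0,
    if μ = 0 ∧ ν = 0 then -(1 / 2) * (w (x 0) * x 2) else 0] l

theorem christoffel_planeWaveSpacetime (hw : ContDiff ℝ ∞ w) (l μ ν : Fin 4) (x : R4) :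
    (planeWaveSpacetime w hw).christoffel l μ ν x = planeWaveChristoffel w l μ ν x := by
  unfold Spacetime.christoffel
  simp only [inverse_planeWaveSpacetime]
  change (1 / 2) * ∑ s, _ * (partialDeriv μ (fun y => planeWave w y ν s) x +
    partialDeriv ν (fun y => planeWave w y μ s) x - partialDeriv s (fun y => planeWave w y μ ν) x)
      = _
  simp only [partialDeriv_planeWave, partialDeriv_brinkmannProfile hw, planeWaveChristoffel]
  fin_cases l <;> fin_cases μ <;> fin_cases ν <;> simp [Fin.sum_univ_succ]

/-- The symbols are trace-free, and `Γ^l` never depends on `x^l`, as `H` has no `x²` or `y²` term.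
The quadratic terms vanish too: a nonzero symbol with a nonzero lower index has upper index `1`, and
`1` never occurs as a lower index. -/
theorem ricci_planeWaveSpacetime (hw : ContDiff ℝ ∞ w) (μ ν : Fin 4) (x : R4) :
    (planeWaveSpacetime w hw).ricci μ ν x = 0 := by
  have hΓ : ∀ l μ ν, (planeWaveSpacetime w hw).christoffel l μ ν = planeWaveChristoffel w l μ ν :=
    fun l μ ν => funext (christoffel_planeWaveSpacetime hw l μ ν)
  have htrace : ∀ l μ, planeWaveChristoffel w l l μ = fun _ => 0 := by
    intro l μ
    funext y
    fin_cases l <;> fin_cases μ <;> simp [planeWaveChristoffel]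
  have hdiv : ∀ l, partialDeriv l (planeWaveChristoffel w l μ ν) x = 0 := by
    intro l
    refine partialDeriv_eq_zero_of_translate fun t => ?_
    fin_cases l <;> simp [planeWaveChristoffel]
  unfold Spacetime.ricci
  simp only [hΓ, htrace, hdiv, partialDeriv_const, sub_zero, Finset.sum_const_zero, zero_add]
  simp only [planeWaveChristoffel, Fin.sum_univ_succ]
  fin_cases μ <;> fin_cases ν <;> simp

theorem planeWaveSpacetime_mem_vacuumSolutions (hw : ContDiff ℝ ∞ w) :
    planeWaveSpacetime w hw ∈ vacuumSolutions := by
  intro x μ ν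
  simp [Spacetime.einstein, Spacetime.scalarCurvature, ricci_planeWaveSpacetime]

end PlaneWave

/-! ### Isometries into a plane wave -/

/-- Lowering the index lets the transformation law be derived without inverting the pulled-back
metric. -/
theorem Spacetime.sum_metric_mul_christoffel (g : Spacetime) (κ μ ν : Fin 4) (x : R4) :
    ∑ l, g.metric x κ l * g.christoffel l μ ν x =
      (1 / 2) * (partialDeriv μ (fun y => g.metric y ν κ) x +
        partialDeriv ν (fun y => g.metric y μ κ) x -
        partialDeriv κ (fun y => g.metric y μ ν) x) := by
  have hdet : IsUnit (Matrix.of (g.metric x)).det := by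
    obtain ⟨-, P, -, hP⟩ := g.lorentzian x
    have h := congrArg Matrix.det hP
    rw [Matrix.det_mul, Matrix.det_mul, Matrix.det_diagonal] at h
    rw [isUnit_iff_ne_zero]
    intro h0
    simp [h0, Fin.prod_univ_succ] at h
  have hinv := Matrix.mul_nonsing_inv _ hdet
  set T : Fin 4 → ℝ := fun s => partialDeriv μ (fun y => g.metric y ν s) x +
    partialDeriv ν (fun y => g.metric y μ s) x - partialDeriv s (fun y => g.metric y μ ν) x with hT
  have h2 : ((Matrix.of (g.metric x)) * (Matrix.of (g.metric x))⁻¹).mulVec T κ = T κ := by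
    rw [hinv, Matrix.one_mulVec]
  rw [← Matrix.mulVec_mulVec] at h2
  change _ = (1 / 2) * T κ
  rw [← h2]
  simp only [Spacetime.christoffel, Matrix.mulVec, dotProduct, Spacetime.inverse, Finset.mul_sum,
    Matrix.of_apply]
  refine Finset.sum_congr rfl fun l _ => Finset.sum_congr rfl fun s _ => ?_
  simp only [hT]
  ring

section Isometry

variable {w : ℝ → ℝ} {f V P Q : R4 → ℝ} {g : Spacetime}

theorem partialDeriv_pullback_planeWave (hw : ContDiff ℝ ∞ w) (hf : ContDiff ℝ ∞ f)
    (hV : ContDiff ℝ ∞ V) (hP : ContDiff ℝ ∞ P) (hQ : ContDiff ℝ ∞ Q) (κ μ ν : Fin 4) (x : R4) :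
    partialDeriv κ (fun y => w (f y) * P y * Q y * (partialDeriv μ f y * partialDeriv ν f y) +
        (1 / 2) * (partialDeriv μ f y * partialDeriv ν V y + partialDeriv μ V y * partialDeriv ν f y)
        + partialDeriv μ P y * partialDeriv ν P y + partialDeriv μ Q y * partialDeriv ν Q y) x =
      (deriv w (f x) * partialDeriv κ f x * P x * Q x + w (f x) * partialDeriv κ P x * Q x +
          w (f x) * P x * partialDeriv κ Q x) * (partialDeriv μ f x * partialDeriv ν f x) +
        w (f x) * P x * Q x * (partialDeriv κ (partialDeriv μ f) x * partialDeriv ν f x +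
          partialDeriv μ f x * partialDeriv κ (partialDeriv ν f) x) +
        (1 / 2) * (partialDeriv κ (partialDeriv μ f) x * partialDeriv ν V x +
          partialDeriv μ f x * partialDeriv κ (partialDeriv ν V) x +
          partialDeriv κ (partialDeriv μ V) x * partialDeriv ν f x +
          partialDeriv μ V x * partialDeriv κ (partialDeriv ν f) x) +
        (partialDeriv κ (partialDeriv μ P) x * partialDeriv ν P x +
          partialDeriv μ P x * partialDeriv κ (partialDeriv ν P) x) +
        (partialDeriv κ (partialDeriv μ Q) x * partialDeriv ν Q x +
          partialDeriv μ Q x * partialDeriv κ (partialDeriv ν Q) x) := by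
  have dw : DifferentiableAt ℝ w (f x) := (hw.differentiable (by norm_num)).differentiableAt
  have df := hf.differentiableAt_infty (x := x)
  have dP := hP.differentiableAt_infty (x := x)
  have dQ := hQ.differentiableAt_infty (x := x)
  have df' := fun μ => (hf.partialDeriv μ).differentiableAt_infty (x := x)
  have dV' := fun μ => (hV.partialDeriv μ).differentiableAt_infty (x := x)
  have dP' := fun μ => (hP.partialDeriv μ).differentiableAt_infty (x := x)
  have dQ' := fun μ => (hQ.partialDeriv μ).differentiableAt_infty (x := x)
  have dwf : DifferentiableAt ℝ (fun y => w (f y)) x := dw.comp x df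
  have dwP := dwf.fun_mul dP
  have dh := dwP.fun_mul dQ
  have dff := (df' μ).fun_mul (df' ν)
  have dfV := (df' μ).fun_mul (dV' ν)
  have dVf := (dV' μ).fun_mul (df' ν)
  have dPP := (dP' μ).fun_mul (dP' ν)
  have dQQ := (dQ' μ).fun_mul (dQ' ν)
  have d1 := dh.fun_mul dff
  have d2 := dfV.fun_add dVf
  have d3 := d2.const_mul (1 / 2)
  have d4 := d1.fun_add d3
  rw [partialDeriv_add (d4.fun_add dPP) dQQ, partialDeriv_add d4 dPP, partialDeriv_add d1 d3,
    partialDeriv_mul dh dff, partialDeriv_const_mul _ d2, partialDeriv_add dfV dVf,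
    partialDeriv_mul dwP dQ, partialDeriv_mul dwf dP, partialDeriv_comp dw df,
    partialDeriv_mul (df' μ) (df' ν), partialDeriv_mul (df' μ) (dV' ν),
    partialDeriv_mul (dV' μ) (df' ν), partialDeriv_mul (dP' μ) (dP' ν),
    partialDeriv_mul (dQ' μ) (dQ' ν)]
  ring

/-- The transformation law of the Christoffel symbols, for a map `(f, V, P, Q)` that pulls the
plane wave with profile `w(u) x y` back to `g`. -/
theorem hessian_of_isometry_planeWave (hw : ContDiff ℝ ∞ w) (hf : ContDiff ℝ ∞ f)
    (hV : ContDiff ℝ ∞ V) (hP : ContDiff ℝ ∞ P) (hQ : ContDiff ℝ ∞ Q)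
    (hg : ∀ x μ ν, g.metric x μ ν =
      w (f x) * P x * Q x * (partialDeriv μ f x * partialDeriv ν f x) +
        (1 / 2) * (partialDeriv μ f x * partialDeriv ν V x + partialDeriv μ V x * partialDeriv ν f x)
        + partialDeriv μ P x * partialDeriv ν P x + partialDeriv μ Q x * partialDeriv ν Q x)
    (hind : ∀ x (a b c d : ℝ), (∀ κ, a * partialDeriv κ f x + b * partialDeriv κ V x +
      c * partialDeriv κ P x + d * partialDeriv κ Q x = 0) → b = 0 ∧ c = 0 ∧ d = 0)
    (μ ν : Fin 4) (x : R4) :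
    partialDeriv μ (partialDeriv ν f) x = ∑ l, g.christoffel l μ ν x * partialDeriv l f x ∧
    partialDeriv μ (partialDeriv ν P) x = ∑ l, g.christoffel l μ ν x * partialDeriv l P x +
      (1 / 2) * (partialDeriv μ f x * partialDeriv ν f x * (w (f x) * Q x)) ∧
    partialDeriv μ (partialDeriv ν Q) x = ∑ l, g.christoffel l μ ν x * partialDeriv l Q x +
      (1 / 2) * (partialDeriv μ f x * partialDeriv ν f x * (w (f x) * P x)) := by
  have hd : ∀ κ μ ν, partialDeriv κ (fun y => g.metric y μ ν) x = _ := fun κ μ ν => by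
    simp only [hg]
    exact partialDeriv_pullback_planeWave hw hf hV hP hQ κ μ ν x
  have hΓ := fun κ => g.sum_metric_mul_christoffel κ μ ν x
  simp only [hd] at hΓ
  simp only [hg] at hΓ
  -- Let `D^σ` be the defect in the transformation law for the `σ`-th component, and `g'` the target
  -- wave. The lowered identity says that the covectors `∂_κ φ^ρ` with coefficients `g'_{ρσ} D^σ`
  -- sum to zero. The coefficient of `∂_κ V` is `D^0 / 2`, since `v` pairs only with `u`; the
  -- Hessian of `V` enters only the coefficient of `∂_κ f`, which is not needed.
  obtain ⟨h1, h2, h3⟩ := hind x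
    (w (f x) * P x * Q x * (partialDeriv μ (partialDeriv ν f) x -
        ∑ l, g.christoffel l μ ν x * partialDeriv l f x) +
      (1 / 2) * (partialDeriv μ (partialDeriv ν V) x -
        ∑ l, g.christoffel l μ ν x * partialDeriv l V x) +
      (1 / 2) * (partialDeriv ν f x * (deriv w (f x) * partialDeriv μ f x * P x * Q x +
          w (f x) * partialDeriv μ P x * Q x + w (f x) * P x * partialDeriv μ Q x) +
        partialDeriv μ f x * (deriv w (f x) * partialDeriv ν f x * P x * Q x +
          w (f x) * partialDeriv ν P x * Q x + w (f x) * P x * partialDeriv ν Q x) -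
        partialDeriv μ f x * partialDeriv ν f x * (deriv w (f x) * P x * Q x)))
    ((1 / 2) * (partialDeriv μ (partialDeriv ν f) x -
        ∑ l, g.christoffel l μ ν x * partialDeriv l f x))
    (partialDeriv μ (partialDeriv ν P) x - ∑ l, g.christoffel l μ ν x * partialDeriv l P x -
      (1 / 2) * (partialDeriv μ f x * partialDeriv ν f x * (w (f x) * Q x)))
    (partialDeriv μ (partialDeriv ν Q) x - ∑ l, g.christoffel l μ ν x * partialDeriv l Q x -
      (1 / 2) * (partialDeriv μ f x * partialDeriv ν f x * (w (f x) * P x))) (fun κ => by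
    have h := hΓ κ
    rw [partialDeriv_comm hf κ μ, partialDeriv_comm hf κ ν, partialDeriv_comm hV κ μ,
      partialDeriv_comm hV κ ν, partialDeriv_comm hP κ μ, partialDeriv_comm hP κ ν,
      partialDeriv_comm hQ κ μ, partialDeriv_comm hQ κ ν, partialDeriv_comm hf ν μ,
      partialDeriv_comm hV ν μ, partialDeriv_comm hP ν μ, partialDeriv_comm hQ ν μ] at h
    simp only [Fin.sum_univ_four] at h ⊢
    linear_combination -h)
  refine ⟨by linarith, by linarith, by linarith⟩

end Isometry

/-! ### Rigidity: parallel gradients and comparison of profiles -/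

section Rigidity

variable {w w₁ w₂ : ℝ → ℝ} {f S : R4 → ℝ}

/-- For `i = 2, 3`, commuting derivatives turns `∂_0 ∂_i f = 0` into `∂_i ∂_0 ∂_0 f = 0`.
Differentiating `h00` along `x^i` then leaves one term in `f` to balance `∂_i S`. -/
theorem partialDeriv_eq_of_oscillator_eq (hw : ContDiff ℝ ∞ w) (hf : ContDiff ℝ ∞ f)
    (hS : ContDiff ℝ ∞ S)
    (h22 : ∀ x, partialDeriv 2 (partialDeriv 2 f) x = 0)
    (h23 : ∀ x, partialDeriv 2 (partialDeriv 3 f) x = 0)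
    (h33 : ∀ x, partialDeriv 3 (partialDeriv 3 f) x = 0)
    (h02 : ∀ x, partialDeriv 0 (partialDeriv 2 f) x = 0)
    (h03 : ∀ x, partialDeriv 0 (partialDeriv 3 f) x = 0)
    (h00 : ∀ x, partialDeriv 0 (partialDeriv 0 f) x =
      -(1 / 2) * (w (x 0) * x 3 * partialDeriv 2 f x + w (x 0) * x 2 * partialDeriv 3 f x) + S x)
    (x : R4) :
    partialDeriv 2 S x = (1 / 2) * (w (x 0) * partialDeriv 3 f x) ∧
      partialDeriv 3 S x = (1 / 2) * (w (x 0) * partialDeriv 2 f x) := by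
  have dw : Differentiable ℝ w := hw.differentiable (by norm_num)
  have dwx : DifferentiableAt ℝ (fun y : R4 => w (y 0)) x := by fun_prop
  have dw3 : DifferentiableAt ℝ (fun y : R4 => w (y 0) * y 3) x := by fun_prop
  have dw2 : DifferentiableAt ℝ (fun y : R4 => w (y 0) * y 2) x := by fun_prop
  have df2 := (hf.partialDeriv 2).differentiableAt_infty (x := x)
  have df3 := (hf.partialDeriv 3).differentiableAt_infty (x := x)
  have dS := hS.differentiableAt_infty (x := x)
  have hzero : ∀ i, (∀ y, partialDeriv 0 (partialDeriv i f) y = 0) →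
      partialDeriv i (partialDeriv 0 (partialDeriv 0 f)) x = 0 := by
    intro i hi
    rw [partialDeriv_comm (hf.partialDeriv 0),
      show partialDeriv i (partialDeriv 0 f) = fun _ => 0 from
        funext fun y => (partialDeriv_comm hf i 0 y).trans (hi y)]
    exact partialDeriv_const 0
  have key : ∀ i, (∀ y, partialDeriv 0 (partialDeriv i f) y = 0) →
      -(1 / 2) * ((deriv w (x 0) * (if 0 = i then 1 else 0) * x 3 +
          w (x 0) * (if 3 = i then 1 else 0)) * partialDeriv 2 f x +
        w (x 0) * x 3 * partialDeriv i (partialDeriv 2 f) x +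
        ((deriv w (x 0) * (if 0 = i then 1 else 0) * x 2 +
          w (x 0) * (if 2 = i then 1 else 0)) * partialDeriv 3 f x +
        w (x 0) * x 2 * partialDeriv i (partialDeriv 3 f) x)) + partialDeriv i S x = 0 := by
    intro i hi
    refine Eq.trans ?_ (hzero i hi)
    rw [show partialDeriv 0 (partialDeriv 0 f) = _ from funext h00,
      partialDeriv_add (((dw3.fun_mul df2).fun_add (dw2.fun_mul df3)).const_mul _) dS,
      partialDeriv_const_mul _ ((dw3.fun_mul df2).fun_add (dw2.fun_mul df3)),
      partialDeriv_add (dw3.fun_mul df2) (dw2.fun_mul df3), partialDeriv_mul dw3 df2,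
      partialDeriv_mul dw2 df3, partialDeriv_mul dwx (by fun_prop),
      partialDeriv_mul dwx (by fun_prop), partialDeriv_comp (dw _) (by fun_prop)]
    simp only [partialDeriv_coord]
  have k2 := key 2 h02
  have k3 := key 3 h03
  rw [h22, h23] at k2
  rw [partialDeriv_comm hf, h23, h33] at k3
  simp at k2 k3
  constructor <;> linarith

/-- A closed covector field `df` that is parallel for the plane wave with profile `w(u) x y`,
`w` nowhere zero, is a constant multiple of `du`. -/
theorem exists_affine_of_parallel (hw : ContDiff ℝ ∞ w) (hw0 : ∀ u, w u ≠ 0)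
    (hf : ContDiff ℝ ∞ f)
    (h : ∀ μ ν x, partialDeriv μ (partialDeriv ν f) x =
      ∑ l, planeWaveChristoffel w l μ ν x * partialDeriv l f x) :
    ∃ a b : ℝ, ∀ x, f x = a * x 0 + b := by
  have dw : Differentiable ℝ w := hw.differentiable (by norm_num)
  have h02 := h 0 2
  have h03 := h 0 3
  have h00 := h 0 0
  have h1 : ∀ ν x, partialDeriv 1 (partialDeriv ν f) x = 0 := fun ν x => by
    rw [h]; simp [planeWaveChristoffel, Fin.sum_univ_four]
  have h22 : ∀ x, partialDeriv 2 (partialDeriv 2 f) x = 0 := fun x => by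
    rw [h]; simp [planeWaveChristoffel, Fin.sum_univ_four]
  have h23 : ∀ x, partialDeriv 2 (partialDeriv 3 f) x = 0 := fun x => by
    rw [h]; simp [planeWaveChristoffel, Fin.sum_univ_four]
  have h33 : ∀ x, partialDeriv 3 (partialDeriv 3 f) x = 0 := fun x => by
    rw [h]; simp [planeWaveChristoffel, Fin.sum_univ_four]
  simp [planeWaveChristoffel, Fin.sum_univ_four] at h02 h03 h00
  have f1 : ∀ x, partialDeriv 1 f x = 0 := by
    intro x
    -- Apply `∂_3` to `∂_0 ∂_2 f = w x³ ∂_1 f`: the left side vanishes and the right side becomes `w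
    -- ∂_1 f`.
    have e1 : partialDeriv 3 (partialDeriv 0 (partialDeriv 2 f)) x = 0 := by
      rw [partialDeriv_comm (hf.partialDeriv 2), show partialDeriv 3 (partialDeriv 2 f) = fun _ => 0
        from funext fun y => (partialDeriv_comm hf 3 2 y).trans (h23 y), partialDeriv_const]
    rw [show partialDeriv 0 (partialDeriv 2 f) = _ from funext h02,
      partialDeriv_mul (by fun_prop) (hf.partialDeriv 1).differentiableAt_infty,
      partialDeriv_mul (by fun_prop) (by fun_prop), partialDeriv_comp (dw _) (by fun_prop),
      partialDeriv_comm hf, h1] at e1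
    simp [partialDeriv_coord, hw0] at e1
    exact e1
  simp only [f1, mul_zero, zero_add] at h02 h03 h00
  have f23 := partialDeriv_eq_of_oscillator_eq hw hf (S := fun _ => 0) contDiff_const h22 h23 h33
    h02 h03 (fun x => by rw [h00]; ring)
  simp only [partialDeriv_const] at f23
  have f3 : ∀ x, partialDeriv 3 f x = 0 := fun x => by simpa [hw0, eq_comm] using (f23 x).1
  have f2 : ∀ x, partialDeriv 2 f x = 0 := fun x => by simpa [hw0, eq_comm] using (f23 x).2
  simp only [f2, f3, mul_zero, add_zero, neg_zero] at h00
  have f0 : ∀ x, partialDeriv 0 f x = partialDeriv 0 f 0 := fun x =>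
    eq_of_partialDeriv_eq_zero (hf.partialDeriv 0) (fun μ y => by
      rw [partialDeriv_comm hf]
      fin_cases μ
      · exact h00 y
      · simp [show partialDeriv 1 f = fun _ => 0 from funext f1, partialDeriv_const]
      · exact h02 y
      · exact h03 y) x 0
  refine ⟨partialDeriv 0 f 0, f 0, fun x => ?_⟩
  have hlin : ∀ x, f x - partialDeriv 0 f 0 * x 0 = f 0 - partialDeriv 0 f 0 * (0 : R4) 0 := by
    intro x
    refine eq_of_partialDeriv_eq_zero (f := fun y => f y - partialDeriv 0 f 0 * y 0)
      (by fun_prop) (fun μ y => ?_) x 0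
    rw [partialDeriv_sub hf.differentiableAt_infty (by fun_prop),
      partialDeriv_const_mul _ (by fun_prop), partialDeriv_coord]
    fin_cases μ <;> simp [f0 y, f1, f2, f3]
  have := hlin x
  simp at this
  linarith

/-- The oscillator lemma with source `(1/2) a² w₂ Q`. It is used twice, the second time with `P` and
`Q` exchanged. -/
theorem partialDeriv_eq_of_hessian_eq (hw₁ : ContDiff ℝ ∞ w₁) (hw₂ : ContDiff ℝ ∞ w₂) {a b : ℝ}
    {P Q : R4 → ℝ} (hP : ContDiff ℝ ∞ P) (hQ : ContDiff ℝ ∞ Q)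
    (hP1 : ∀ x, partialDeriv 1 P x = 0)
    (h : ∀ μ ν x, partialDeriv μ (partialDeriv ν P) x =
      ∑ l, planeWaveChristoffel w₁ l μ ν x * partialDeriv l P x +
      (1 / 2) * ((if 0 = μ then a else 0) * (if 0 = ν then a else 0) *
        (w₂ (a * x 0 + b) * Q x))) (x : R4) :
    a ^ 2 * w₂ (a * x 0 + b) * partialDeriv 2 Q x = w₁ (x 0) * partialDeriv 3 P x ∧
      a ^ 2 * w₂ (a * x 0 + b) * partialDeriv 3 Q x = w₁ (x 0) * partialDeriv 2 P x := by
  have dw₂ : Differentiable ℝ w₂ := hw₂.differentiable (by norm_num)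
  have hS : ContDiff ℝ ∞ fun y : R4 => (1 / 2) * (a ^ 2 * (w₂ (a * y 0 + b) * Q y)) := by
    fun_prop
  have hz : ∀ μ ν, ν ≠ 0 → ∀ x, partialDeriv μ (partialDeriv ν P) x = 0 := by
    intro μ ν hν x
    rw [h, if_neg hν.symm]
    fin_cases μ <;> fin_cases ν <;> simp [planeWaveChristoffel, Fin.sum_univ_four, hP1] at hν ⊢
  have key := partialDeriv_eq_of_oscillator_eq hw₁ hP hS (hz 2 2 (by simp))
    (hz 2 3 (by simp)) (hz 3 3 (by simp)) (hz 0 2 (by simp))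
    (hz 0 3 (by simp)) (fun x => by
      rw [h]
      simp [planeWaveChristoffel, Fin.sum_univ_four, hP1]
      ring) x
  have hi : ∀ i : Fin 4, 0 ≠ i →
      partialDeriv i (fun y : R4 => (1 / 2) * (a ^ 2 * (w₂ (a * y 0 + b) * Q y))) x =
        (1 / 2) * (a ^ 2 * (w₂ (a * x 0 + b) * partialDeriv i Q x)) := by
    intro i hi
    have dQ := hQ.differentiableAt_infty (x := x)
    have dwa : DifferentiableAt ℝ (fun y : R4 => w₂ (a * y 0 + b)) x := by fun_prop
    rw [partialDeriv_const_mul _ ((dwa.fun_mul dQ).const_mul _),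
      partialDeriv_const_mul _ (dwa.fun_mul dQ), partialDeriv_mul dwa dQ,
      partialDeriv_comp (dw₂ _) (by fun_prop), partialDeriv_add (by fun_prop) (by fun_prop),
      partialDeriv_const_mul _ (by fun_prop), partialDeriv_coord, partialDeriv_const, if_neg hi]
    ring
  rw [hi 2 (by simp), hi 3 (by simp)] at key
  constructor <;> linarith [key.1, key.2]

/-- Isometric plane waves with positive profiles `w(u) x y` have profiles that agree up to an affine
change of the parameter `u`. -/
theorem profile_eq_of_diffEquivalent (hw₁ : ContDiff ℝ ∞ w₁) (hw₂ : ContDiff ℝ ∞ w₂)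
    (pos₁ : ∀ u, 0 < w₁ u) (pos₂ : ∀ u, 0 < w₂ u)
    (h : DiffEquivalent (planeWaveSpacetime w₂ hw₂) (planeWaveSpacetime w₁ hw₁)) :
    ∃ a b : ℝ, ∀ u, w₁ u = a ^ 2 * w₂ (a * u + b) := by
  obtain ⟨φ, hφ⟩ := h
  have cφ : ContDiff ℝ ∞ φ := φ.contMDiff.contDiff
  have cψ : ContDiff ℝ ∞ φ.symm := φ.symm.contMDiff.contDiff
  have cc : ∀ ρ, ContDiff ℝ ∞ (fun y => φ y ρ) := fun ρ => contDiff_pi.1 cφ ρ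
  have hg : ∀ x μ ν, planeWave w₁ x μ ν =
      w₂ (φ x 0) * φ x 2 * φ x 3 *
          (partialDeriv μ (fun y => φ y 0) x * partialDeriv ν (fun y => φ y 0) x) +
        (1 / 2) * (partialDeriv μ (fun y => φ y 0) x * partialDeriv ν (fun y => φ y 1) x +
          partialDeriv μ (fun y => φ y 1) x * partialDeriv ν (fun y => φ y 0) x) +
        partialDeriv μ (fun y => φ y 2) x * partialDeriv ν (fun y => φ y 2) x +
        partialDeriv μ (fun y => φ y 3) x * partialDeriv ν (fun y => φ y 3) x := by
    intro x μ ν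
    refine (hφ x μ ν).trans ?_
    change ∑ ρ, ∑ σ, _ * _ * planeWave w₂ (φ x) ρ σ = _
    simp [Fin.sum_univ_four, planeWave]
    ring
  have hind : ∀ x (a : Fin 4 → ℝ), (∀ κ, ∑ ρ, a ρ * partialDeriv κ (fun y => φ y ρ) x = 0) →
      a = 0 := by
    intro x a ha
    -- The derivative of the inverse map makes `dφ` surjective, so no nonzero row combination
    -- annihilates its image.
    have hcomp : ∀ v, fderiv ℝ φ x (fderiv ℝ φ.symm (φ x) v) = v := by
      intro v
      have h1 := fderiv_comp (φ x) (g := φ) (f := φ.symm)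
        (cφ.differentiable (by norm_num)).differentiableAt
        (cψ.differentiable (by norm_num)).differentiableAt
      have h2 : (φ : R4 → R4) ∘ φ.symm = id := funext fun y => φ.apply_symm_apply y
      rw [h2, fderiv_id, φ.symm_apply_apply] at h1
      exact (congrArg (fun L => L v) h1).symm
    have hrow : ∀ v, ∑ ρ, a ρ * fderiv ℝ φ x v ρ = 0 := by
      intro v
      have hc : ∀ ρ, fderiv ℝ φ x v ρ = ∑ κ, v κ * partialDeriv κ (fun y => φ y ρ) x := by
        intro ρ
        rw [← fderiv_apply_eq_sum_partialDeriv,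
          fderiv_apply (cφ.differentiable (by norm_num)).differentiableAt]
        rfl
      simp only [hc, Finset.mul_sum]
      rw [Finset.sum_comm]
      refine Finset.sum_eq_zero fun κ _ => ?_
      rw [← mul_zero (v κ), ← ha κ, Finset.mul_sum]
      exact Finset.sum_congr rfl fun ρ _ => by ring
    funext ρ
    have := hrow (fderiv ℝ φ.symm (φ x) (Pi.single ρ 1))
    rw [hcomp] at this
    simpa [Pi.single_apply] using this
  have hhess := hessian_of_isometry_planeWave (g := planeWaveSpacetime w₁ hw₁) hw₂ (cc 0) (cc 1)
    (cc 2) (cc 3) hg (fun x a b c d hk => by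
      have := hind x ![a, b, c, d] (fun κ => by simpa [Fin.sum_univ_four] using hk κ)
      exact ⟨congrFun this 1, congrFun this 2, congrFun this 3⟩)
  simp only [christoffel_planeWaveSpacetime] at hhess
  generalize hP : (fun y => φ y 2) = P at *
  generalize hQ : (fun y => φ y 3) = Q at *
  have cP : ContDiff ℝ ∞ P := hP ▸ cc 2
  have cQ : ContDiff ℝ ∞ Q := hQ ▸ cc 3
  obtain ⟨a, b, hab⟩ := exists_affine_of_parallel hw₁ (fun u => (pos₁ u).ne') (cc 0)
    (fun μ ν x => (hhess μ ν x).1)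
  have hf : (fun y => φ y 0) = fun y => a * y 0 + b := funext hab
  have df : ∀ μ x, partialDeriv μ (fun y => φ y 0) x = if (0 : Fin 4) = μ then a else 0 := by
    intro μ x
    rw [hf, partialDeriv_add (by fun_prop) (by fun_prop), partialDeriv_const_mul _ (by fun_prop),
      partialDeriv_coord, partialDeriv_const]
    simp
  -- As `∂_v` is null and `∂_v f = 0`, the `vv` component is a vanishing sum of two squares.
  have h11 : ∀ x, partialDeriv 1 P x = 0 ∧ partialDeriv 1 Q x = 0 := by
    intro x
    have := hg x 1 1
    simp [df, planeWave] at this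
    constructor <;> nlinarith [sq_nonneg (partialDeriv 1 P x), sq_nonneg (partialDeriv 1 Q x)]
  have h22 : ∀ x, partialDeriv 2 P x * partialDeriv 2 P x +
      partialDeriv 2 Q x * partialDeriv 2 Q x = 1 := by
    intro x
    have := hg x 2 2
    simp [df, planeWave] at this
    exact this.symm
  refine ⟨a, b, fun u => ?_⟩
  set x : R4 := Pi.single 0 u with hx
  have hx0 : x 0 = u := by simp [hx]
  have hPx : ∀ x, φ x 2 = P x := congrFun hP
  have hQx : ∀ x, φ x 3 = Q x := congrFun hQ
  simp only [df] at hhess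
  simp only [hab, hPx, hQx] at hhess
  have kP := partialDeriv_eq_of_hessian_eq hw₁ hw₂ cP cQ (fun x => (h11 x).1)
    (fun μ ν x => (hhess μ ν x).2.1) x
  have kQ := partialDeriv_eq_of_hessian_eq hw₁ hw₂ cQ cP (fun x => (h11 x).2)
    (fun μ ν x => (hhess μ ν x).2.2) x
  rw [hx0] at kP kQ
  obtain ⟨p1, p2⟩ := kP
  obtain ⟨q1, q2⟩ := kQ
  have h1 := pos₁ u
  have h2 : 0 ≤ a ^ 2 * w₂ (a * u + b) := mul_nonneg (sq_nonneg a) (pos₂ _).le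
  generalize a ^ 2 * w₂ (a * u + b) = s at *
  -- Composing the two relations between `P` and `Q` gives the factor `w₁² - s²`; the unit length of
  -- `∂_x` in `h22` then forces that factor to vanish.
  have hP2 : (w₁ u ^ 2 - s ^ 2) * partialDeriv 2 P x = 0 := by
    linear_combination -w₁ u * p2 - s * q1
  have hQ2 : (w₁ u ^ 2 - s ^ 2) * partialDeriv 2 Q x = 0 := by
    linear_combination -w₁ u * q2 - s * p1
  have hsq : (w₁ u - s) * (w₁ u + s) = 0 := by
    linear_combination partialDeriv 2 P x * hP2 + partialDeriv 2 Q x * hQ2 -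
      (w₁ u ^ 2 - s ^ 2) * h22 x
  rcases mul_eq_zero.1 hsq with h | h <;> linarith

end Rigidity

/-! ### Pulse trains -/

namespace IsBellCurve

variable {W : ℝ → ℝ}

theorem apply_zero (hW : IsBellCurve W) : W 0 = 0 := by
  have hc : Filter.Tendsto W (nhdsWithin 0 (Set.Iio 0)) (nhds (W 0)) :=
    hW.smooth.continuous.continuousAt.tendsto.mono_left nhdsWithin_le_nhds
  refine tendsto_nhds_unique hc (tendsto_const_nhds.congr' ?_)
  filter_upwards [self_mem_nhdsWithin] with x hx
  exact (hW.eq_zero x fun h => not_lt.2 h.1 hx).symm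

theorem apply_one (hW : IsBellCurve W) : W 1 = 0 := by
  have hc : Filter.Tendsto W (nhdsWithin 1 (Set.Ioi 1)) (nhds (W 1)) :=
    hW.smooth.continuous.continuousAt.tendsto.mono_left nhdsWithin_le_nhds
  refine tendsto_nhds_unique hc (tendsto_const_nhds.congr' ?_)
  filter_upwards [self_mem_nhdsWithin] with x hx
  exact (hW.eq_zero x fun h => not_lt.2 h.2 hx).symm

theorem eq_zero_of_nonpos (hW : IsBellCurve W) {x : ℝ} (hx : x ≤ 0) : W x = 0 := by
  rcases hx.eq_or_lt with rfl | h
  · exact hW.apply_zero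
  · exact hW.eq_zero x fun h' => not_lt.2 h'.1 h

theorem eq_zero_of_one_le (hW : IsBellCurve W) {x : ℝ} (hx : 1 ≤ x) : W x = 0 := by
  rcases hx.eq_or_lt with rfl | h
  · exact hW.apply_one
  · exact hW.eq_zero x fun h' => not_lt.2 h'.2 h

end IsBellCurve

/-- The sign of the `n`-th pulse: `1` if `α n = 1` and `-1` if `α n = 0`. -/
def pulseSign (α : BernoulliSpace) (n : ℤ) : ℝ := if α n = true then 1 else -1

theorem pulseSign_eq_one_or (α : BernoulliSpace) (n : ℤ) :
    pulseSign α n = 1 ∨ pulseSign α n = -1 := by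
  unfold pulseSign
  split_ifs <;> simp

theorem pulseSign_inj {α β : BernoulliSpace} {m n : ℤ} (h : pulseSign α m = pulseSign β n) :
    α m = β n := by
  unfold pulseSign at h
  rcases hα : α m <;> rcases hβ : β n <;> simp [hα, hβ] at h ⊢ <;> norm_num at h

theorem pulseTrain_eq (W : ℝ → ℝ) (α : BernoulliSpace) (u : ℝ) :
    pulseTrain W α u = 2 + pulseSign α ⌊u⌋ * W (Int.fract u) := by
  unfold pulseTrain pulseSign
  rw [Int.self_sub_floor]
  split_ifs <;> ring

theorem pulseTrain_int_add (W : ℝ → ℝ) (α : BernoulliSpace) (n : ℤ) {t : ℝ} (h0 : 0 ≤ t)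
    (h1 : t < 1) : pulseTrain W α (n + t) = 2 + pulseSign α n * W t := by
  have hfl : ⌊(n : ℝ) + t⌋ = n := by
    rw [Int.floor_eq_iff]
    constructor <;> linarith
  rw [pulseTrain_eq, Int.fract, hfl, add_sub_cancel_left]

theorem pulseTrain_smul (W : ℝ → ℝ) (k : Multiplicative ℤ) (α : BernoulliSpace) (u : ℝ) :
    pulseTrain W (k • α) u = pulseTrain W α (u - k.toAdd) := by
  have h : (k • α) ⌊u⌋ = α (⌊u⌋ - k.toAdd) := rfl
  unfold pulseTrain
  rw [h, Int.floor_sub_intCast]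
  push_cast
  rw [sub_sub_sub_cancel_right]

section PulseTrain

variable {W : ℝ → ℝ} {α β : BernoulliSpace}

theorem contDiff_pulseTrain (hW : IsBellCurve W) (α : BernoulliSpace) :
    ContDiff ℝ ∞ (pulseTrain W α) := by
  have hs := hW.smooth
  rw [contDiff_iff_contDiffAt]
  intro u
  -- Near `u` only two neighbouring pulses matter, and each is smooth on all of `ℝ` after extension
  -- by zero.
  have hloc : (fun t : ℝ => 2 + pulseSign α (⌊u⌋ - 1) * W (t - ⌊u⌋ + 1) +
      pulseSign α ⌊u⌋ * W (t - ⌊u⌋)) =ᶠ[nhds u] pulseTrain W α := by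
    have h1 : ((⌊u⌋ : ℝ) - 1) < u := by linarith [Int.floor_le u]
    filter_upwards [Ioo_mem_nhds h1 (Int.lt_floor_add_one u)] with t ht
    rcases lt_or_ge t ⌊u⌋ with h | h
    · have := pulseTrain_int_add W α (⌊u⌋ - 1) (t := t - ⌊u⌋ + 1) (by linarith [ht.1])
        (by linarith)
      push_cast at this
      rw [hW.eq_zero_of_nonpos (x := t - ⌊u⌋) (by linarith), mul_zero, add_zero, ← this]
      congr 1
      ring
    · have := pulseTrain_int_add W α ⌊u⌋ (t := t - ⌊u⌋) (by linarith) (by linarith [ht.2])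
      rw [hW.eq_zero_of_one_le (x := t - ⌊u⌋ + 1) (by linarith), mul_zero, add_zero, ← this]
      congr 1
      ring
  refine ContDiffAt.congr_of_eventuallyEq ?_ hloc.symm
  fun_prop

theorem one_le_pulseTrain (hW : IsBellCurve W) (α : BernoulliSpace) (u : ℝ) :
    1 ≤ pulseTrain W α u := by
  have h := hW.mem_Icc (Int.fract u)
  rw [pulseTrain_eq]
  rcases pulseSign_eq_one_or α ⌊u⌋ with h' | h' <;> rw [h'] <;> linarith [h.1, h.2]

/-- The maximum and the minimum of a pulse train. -/
theorem exists_isGreatest_isLeast_range_pulseTrain (hW : IsBellCurve W) (α : BernoulliSpace) :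
    ∃ M m : ℝ, IsGreatest (Set.range (pulseTrain W α)) M ∧
      IsLeast (Set.range (pulseTrain W α)) m ∧
      ((M = 3 ∧ m = 1) ∨ (M = 3 ∧ m = 2) ∨ (M = 2 ∧ m = 1)) := by
  obtain ⟨x₀, hx₀, hpeak, -⟩ := hW.peak
  have h0 : 0 < x₀ := by
    by_contra h
    rw [hW.eq_zero_of_nonpos (not_lt.1 h)] at hpeak
    norm_num at hpeak
  have hval : ∀ n : ℤ, pulseTrain W α (n + x₀) = 2 + pulseSign α n := fun n => by
    rw [pulseTrain_int_add W α n h0.le (by linarith), hpeak, mul_one]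
  have htwo : pulseTrain W α 0 = 2 := by
    simpa [hW.apply_zero] using pulseTrain_int_add W α 0 le_rfl zero_lt_one
  have hle : ∀ u, pulseTrain W α u ≤ 3 := fun u => by
    have h := hW.mem_Icc (Int.fract u)
    rw [pulseTrain_eq]
    rcases pulseSign_eq_one_or α ⌊u⌋ with h' | h' <;> rw [h'] <;> linarith [h.1, h.2]
  have hge := one_le_pulseTrain hW α
  have hmax : ∀ n, pulseSign α n = 1 → IsGreatest (Set.range (pulseTrain W α)) 3 := fun n hn =>
    ⟨⟨n + x₀, by rw [hval, hn]; norm_num⟩, by rintro _ ⟨u, rfl⟩; exact hle u⟩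
  have hmin : ∀ n, pulseSign α n = -1 → IsLeast (Set.range (pulseTrain W α)) 1 := fun n hn =>
    ⟨⟨n + x₀, by rw [hval, hn]; norm_num⟩, by rintro _ ⟨u, rfl⟩; exact hge u⟩
  by_cases h1 : ∃ n, pulseSign α n = 1
  · obtain ⟨n, hn⟩ := h1
    by_cases h2 : ∃ n, pulseSign α n = -1
    · obtain ⟨n', hn'⟩ := h2
      exact ⟨3, 1, hmax n hn, hmin n' hn', by norm_num⟩
    · refine ⟨3, 2, hmax n hn, ⟨⟨0, htwo⟩, ?_⟩, by norm_num⟩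
      rintro _ ⟨u, rfl⟩
      rw [pulseTrain_eq, (pulseSign_eq_one_or α ⌊u⌋).resolve_right fun h => h2 ⟨_, h⟩]
      linarith [(hW.mem_Icc (Int.fract u)).1]
  · have hall : ∀ n, pulseSign α n = -1 := fun n =>
      (pulseSign_eq_one_or α n).resolve_left fun h => h1 ⟨_, h⟩
    refine ⟨2, 1, ⟨⟨0, htwo⟩, ?_⟩, hmin 0 (hall 0), by norm_num⟩
    rintro _ ⟨u, rfl⟩
    rw [pulseTrain_eq, hall]
    linarith [(hW.mem_Icc (Int.fract u)).1]

/-- The ranges differ by the factor `a²`, and the possible ratios of maximum to minimum, `3`, `3/2`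
and `2`, are distinct. So the extrema agree and `a² = 1`. -/
theorem sq_eq_one_of_pulseTrain_eq (hW : IsBellCurve W) {a b : ℝ}
    (h : ∀ u, pulseTrain W β u = a ^ 2 * pulseTrain W α (a * u + b)) : a ^ 2 = 1 := by
  have ha : a ≠ 0 := by
    rintro rfl
    have := one_le_pulseTrain hW β 0
    rw [h] at this
    norm_num at this
  have hrange : Set.range (pulseTrain W β) = (a ^ 2 * ·) '' Set.range (pulseTrain W α) := by
    ext y
    constructor
    · rintro ⟨u, rfl⟩
      exact ⟨_, ⟨a * u + b, rfl⟩, (h u).symm⟩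
    · rintro ⟨_, ⟨u, rfl⟩, rfl⟩
      refine ⟨(u - b) / a, ?_⟩
      rw [h, mul_div_cancel₀ _ ha, sub_add_cancel]
  have hmono : Monotone (a ^ 2 * · : ℝ → ℝ) := fun x y hxy =>
    mul_le_mul_of_nonneg_left hxy (sq_nonneg a)
  obtain ⟨M, m, hM, hm, hα⟩ := exists_isGreatest_isLeast_range_pulseTrain hW α
  obtain ⟨M', m', hM', hm', hβ⟩ := exists_isGreatest_isLeast_range_pulseTrain hW β
  rw [hrange] at hM' hm'
  have e1 := hM'.unique (hmono.map_isGreatest hM)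
  have e2 := hm'.unique (hmono.map_isLeast hm)
  rcases hα with ⟨rfl, rfl⟩ | ⟨rfl, rfl⟩ | ⟨rfl, rfl⟩ <;>
    rcases hβ with ⟨rfl, rfl⟩ | ⟨rfl, rfl⟩ | ⟨rfl, rfl⟩ <;> linarith

theorem mem_orbit_of_forall_apply_add_eq {m : ℤ} (h : ∀ n, β n = α (n + m)) :
    β ∈ MulAction.orbit (Multiplicative ℤ) α := by
  refine ⟨Multiplicative.ofAdd (-m), funext fun n => ?_⟩
  change α (n - -m) = β n
  rw [h, sub_neg_eq_add]

theorem mem_orbit_of_pulseTrain_eq (hW : IsBellCurve W) {a b : ℝ}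
    (h : ∀ u, pulseTrain W β u = a ^ 2 * pulseTrain W α (a * u + b)) :
    β ∈ MulAction.orbit (Multiplicative ℤ) α := by
  have ha := sq_eq_one_of_pulseTrain_eq hW h
  simp only [ha, one_mul] at h
  obtain ⟨x₀, hx₀, hpeak, huniq⟩ := hW.peak
  have h0 : 0 < x₀ := by
    by_contra h
    rw [hW.eq_zero_of_nonpos (not_lt.1 h)] at hpeak
    norm_num at hpeak
  have hval : ∀ α (n : ℤ), pulseTrain W α (n + x₀) = 2 + pulseSign α n := fun α n => by
    rw [pulseTrain_int_add W α n h0.le (by linarith), hpeak, mul_one]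
  -- At a peak the train deviates from `2` by exactly `1`, so peaks go to peaks.
  have hfract : Int.fract (a * x₀ + b) = x₀ := by
    refine huniq _ ?_
    have h1 := h x₀
    have h2 := hval β 0
    rw [Int.cast_zero, zero_add] at h2
    rw [h2, pulseTrain_eq, add_right_inj] at h1
    have h3 := (hW.mem_Icc (Int.fract (a * x₀ + b))).1
    rcases pulseSign_eq_one_or β 0 with e | e <;>
      rcases pulseSign_eq_one_or α ⌊a * x₀ + b⌋ with e' | e' <;> rw [e, e'] at h1 <;> linarith
  set m := ⌊a * x₀ + b⌋ with hm
  have hb : a * x₀ + b = m + x₀ := (Int.floor_add_fract _).symm.trans (by rw [hfract])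
  rcases mul_self_eq_one_iff.1 ((pow_two a).symm.trans ha) with rfl | rfl
  · refine mem_orbit_of_forall_apply_add_eq (m := m) fun n => pulseSign_inj ?_
    have := h (n + x₀)
    rw [hval, show 1 * ((n : ℝ) + x₀) + b = ((n + m : ℤ) : ℝ) + x₀ by push_cast; linarith,
      hval] at this
    linarith
  · have hrefl : ∀ n, pulseSign β n = pulseSign α (m - n) := by
      intro n
      have := h (n + x₀)
      rw [hval, show -1 * ((n : ℝ) + x₀) + b = ((m - n : ℤ) : ℝ) + x₀ by push_cast; linarith,
        hval] at this
      linarith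
    by_cases hconst : ∀ n, α n = α (n - 1)
    · have hc : ∀ n, α n = α 0 := by
        intro n
        induction n with
        | zero => rfl
        | succ n ih => rw [hconst, add_sub_cancel_right, ih]
        | pred n ih => rw [← hconst, ih]
      refine mem_orbit_of_forall_apply_add_eq (m := 0) fun n => ?_
      rw [pulseSign_inj (hrefl n), hc, hc (n + 0)]
    · push Not at hconst
      obtain ⟨j, hj⟩ := hconst
      exfalso
      -- The reflection about a peak carries the part of a cell beyond `2 x₀` into the preceding
      -- cell. Where the signs of these cells differ, two nonnegative values of `W` are opposite,
      -- hence zero. This and the next step use `2 x₀ < 1`.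
      have htail : ∀ t, 2 * x₀ < t → W t = 0 := by
        intro t ht
        rcases le_or_gt 1 t with h1 | h1
        · exact hW.eq_zero_of_one_le h1
        have e := h ((m - j : ℤ) + t)
        rw [pulseTrain_int_add W β _ (by linarith) h1,
          show -1 * (((m - j : ℤ) : ℝ) + t) + b = ((j - 1 : ℤ) : ℝ) + (2 * x₀ + 1 - t) by
            push_cast; linarith,
          pulseTrain_int_add W α _ (by linarith) (by linarith), hrefl, sub_sub_cancel] at e
        have p1 := (hW.mem_Icc t).1
        have p2 := (hW.mem_Icc (2 * x₀ + 1 - t)).1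
        have hne : pulseSign α j ≠ pulseSign α (j - 1) := fun e => hj (pulseSign_inj e)
        rcases pulseSign_eq_one_or α j with e1 | e1 <;>
          rcases pulseSign_eq_one_or α (j - 1) with e2 | e2 <;> rw [e1, e2] at e hne
        · exact absurd rfl hne
        · linarith
        · linarith
        · exact absurd rfl hne
      -- Within one cell the reflection preserves `[0, 2 x₀]`, and `W` vanishes outside that
      -- interval.
      have hsymm : ∀ t, W t = W (2 * x₀ - t) := by
        intro t
        rcases lt_or_ge t 0 with h1 | h1
        · rw [hW.eq_zero_of_nonpos h1.le, htail _ (by linarith)]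
        rcases lt_or_ge (2 * x₀) t with h2 | h2
        · rw [htail t h2, hW.eq_zero_of_nonpos (by linarith)]
        have e := h ((0 : ℤ) + t)
        rw [pulseTrain_int_add W β _ h1 (by linarith),
          show -1 * (((0 : ℤ) : ℝ) + t) + b = (m : ℝ) + (2 * x₀ - t) by push_cast; linarith,
          pulseTrain_int_add W α _ (by linarith) (by linarith), hrefl, sub_zero] at e
        rcases pulseSign_eq_one_or α m with e1 | e1 <;> rw [e1] at e <;> linarith
      obtain ⟨t, ht⟩ := hW.asymmetric x₀
      exact ht (by rw [hsymm]; congr 1; ring)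

end PulseTrain

/-! ### Generic ergodicity of the Bernoulli shift -/

section Bernoulli

instance : PolishSpace BernoulliSpace := by
  have h : PolishSpace (ℤ → Bool) := {}
  exact h

theorem isPolishGSpace_bernoulliSpace : IsPolishGSpace (Multiplicative ℤ) BernoulliSpace where
  topologicalGroup := inferInstance
  polishGroup := inferInstance
  polishSpace := inferInstance
  continuous_smul := ⟨continuous_prod_of_discrete_left.2 fun k =>
    continuous_pi fun n => continuous_apply (A := fun _ : ℤ => Bool) (n - k.toAdd)⟩

/-- A neighbourhood of `α` contains every configuration that agrees with `α` on some window. -/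
theorem exists_window_of_mem_nhds {α : BernoulliSpace} {s : Set BernoulliSpace} (hs : s ∈ nhds α) :
    ∃ N : ℤ, ∀ β : BernoulliSpace, (∀ n, |n| ≤ N → β n = α n) → β ∈ s := by
  classical
  have hs' := hs
  erw [nhds_pi, Filter.mem_pi'] at hs'
  obtain ⟨I, t, ht, hI⟩ := hs'
  obtain ⟨N, hN⟩ := (I.image fun n => |n|).bddAbove
  refine ⟨N, fun β hβ => hI fun n hn => ?_⟩
  rw [hβ n (hN (Finset.mem_coe.2 (Finset.mem_image_of_mem _ hn)))]
  exact mem_of_mem_nhds (ht n)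

/-- Orbits are countable and no point is isolated: a coordinate outside any window can be flipped.
-/
theorem isMeagre_orbit_bernoulliSpace (α : BernoulliSpace) :
    IsMeagre (MulAction.orbit (Multiplicative ℤ) α) := by
  rw [MulAction.orbit, ← Set.iUnion_singleton_eq_range]
  refine isMeagre_iUnion fun k => IsNowhereDense.isMeagre ?_
  generalize k • α = β
  rw [IsClosed.isNowhereDense_iff (isClosed_singleton (x := β))]
  by_contra hne
  obtain ⟨γ, hγ⟩ := Set.nonempty_iff_ne_empty.2 hne
  obtain ⟨N, hN⟩ := exists_window_of_mem_nhds (mem_interior_iff_mem_nhds.1 hγ)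
  have h1 : γ = β := Set.mem_singleton_iff.1 (interior_subset hγ)
  have h2 : Function.update γ (|N| + 1) (!γ (|N| + 1)) = β := by
    refine hN _ fun n hn => Function.update_of_ne ?_ _ _
    rintro rfl
    have := le_abs_self (|N| + 1)
    have := le_abs_self N
    linarith
  have h3 := congrFun (h2.trans h1.symm) (|N| + 1)
  exact Bool.not_ne_self _ ((Function.update_self (f := (γ : ℤ → Bool)) _ _).symm.trans h3)

/-- By Baire, some point lies in all of the countably many dense open sets "the orbit meets `b`",
for `b` in a countable basis. -/
theorem exists_dense_orbit_bernoulliSpace :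
    ∃ α : BernoulliSpace, Dense (MulAction.orbit (Multiplicative ℤ) α) := by
  have : ContinuousSMul (Multiplicative ℤ) BernoulliSpace :=
    isPolishGSpace_bernoulliSpace.continuous_smul
  have hB := TopologicalSpace.isBasis_countableBasis BernoulliSpace
  have hdense : Dense (⋂ b ∈ TopologicalSpace.countableBasis BernoulliSpace,
      ⋃ k : Multiplicative ℤ, (fun α : BernoulliSpace => k • α) ⁻¹' b) := by
    refine dense_biInter_of_isOpen (fun b hb => isOpen_iUnion fun k =>
      (hB.isOpen hb).preimage (continuous_const_smul k))
      (TopologicalSpace.countable_countableBasis _) fun b hb => ?_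
    rw [dense_iff_inter_open]
    rintro U hU ⟨α, hα⟩
    obtain ⟨β, hβ⟩ := TopologicalSpace.nonempty_of_mem_countableBasis hb
    obtain ⟨N, hN⟩ := exists_window_of_mem_nhds (hU.mem_nhds hα)
    obtain ⟨M, hM⟩ := exists_window_of_mem_nhds ((hB.isOpen hb).mem_nhds hβ)
    -- A shift this long makes the windows around `α` and `β` disjoint, so one sequence can show
    -- both patterns.
    let k : ℤ := |N| + |M| + 1
    refine ⟨fun n => if |n| ≤ N then α n else β (n - k), hN _ fun n hn => if_pos hn,
      Set.mem_iUnion.2 ⟨Multiplicative.ofAdd (-k), hM _ fun n hn => ?_⟩⟩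
    have hk : ¬|n + k| ≤ N := by
      have h1 := neg_abs_le n
      have h2 := le_abs_self (n + k)
      have h3 := le_abs_self N
      have h4 := le_abs_self M
      omega
    change (if |n - -k| ≤ N then α (n - -k) else β (n - -k - k)) = β n
    rw [sub_neg_eq_add, if_neg hk]
    congr 1
    ring
  have : Nonempty BernoulliSpace := ⟨fun _ => true⟩
  obtain ⟨α, hα⟩ := hdense.nonempty
  refine ⟨α, hB.dense_iff.2 fun b hb _ => ?_⟩
  obtain ⟨k, hk⟩ := Set.mem_iUnion.1 (Set.mem_iInter₂.1 hα b hb)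
  exact ⟨k • α, hk, k, rfl⟩

theorem isGenericallyErgodic_bernoulliSpace :
    IsGenericallyErgodic (Multiplicative ℤ) BernoulliSpace where
  toIsPolishGSpace := isPolishGSpace_bernoulliSpace
  exists_dense_orbit := exists_dense_orbit_bernoulliSpace
  meager_orbit := isMeagre_orbit_bernoulliSpace

end Bernoulli

/-! ### A bell curve -/

theorem exists_isBellCurve : ∃ W : ℝ → ℝ, IsBellCurve W := by
  -- The exponent `9 - 1/x - 4/(1-x)` equals `-(1-3x)²/(x(1-x))`. Thus `exp 9` normalises the
  -- maximum to `1`, attained only at `1/3`.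
  set W : ℝ → ℝ := fun x => Real.exp 9 * (expNegInvGlue x * expNegInvGlue ((1 - x) / 4)) with hW
  have hzero : ∀ x, x ∉ Set.Ioo (0 : ℝ) 1 → W x = 0 := by
    intro x hx
    rcases le_or_gt x 0 with h | h
    · simp [hW, expNegInvGlue.zero_of_nonpos h]
    · have h1 : 1 ≤ x := not_lt.1 fun h1 => hx ⟨h, h1⟩
      simp [hW, expNegInvGlue.zero_of_nonpos (show (1 - x) / 4 ≤ 0 by linarith)]
  have hval : ∀ x ∈ Set.Ioo (0 : ℝ) 1, W x = Real.exp (-((1 - 3 * x) ^ 2 / (x * (1 - x)))) := by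
    rintro x ⟨h0, h1⟩
    have h2 : 0 < 1 - x := by linarith
    simp only [hW, expNegInvGlue, if_neg h0.not_ge, if_neg (show ¬(1 - x) / 4 ≤ 0 by linarith)]
    rw [← Real.exp_add, ← Real.exp_add]
    congr 1
    field_simp
    ring
  have hpeak : W (1 / 3) = 1 := by
    rw [hval _ (by norm_num)]
    norm_num
  have huniq : ∀ x, W x = 1 → x = 1 / 3 := by
    intro x hx
    by_cases h : x ∈ Set.Ioo (0 : ℝ) 1
    · rw [hval x h, Real.exp_eq_one_iff, neg_eq_zero, div_eq_zero_iff] at hx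
      rcases hx with hx | hx
      · have := pow_eq_zero_iff (two_ne_zero) |>.1 hx
        linarith
      · have h2 : 0 < 1 - x := by linarith [h.2]
        exact absurd hx (mul_pos h.1 h2).ne'
    · rw [hzero x h] at hx
      norm_num at hx
  refine ⟨W, ?_, fun x hx => hzero x fun h => hx (Set.Ioo_subset_Icc_self h), fun x => ?_,
    ⟨1 / 3, by norm_num, hpeak, huniq⟩, fun c => ?_⟩
  · have h1 : ContDiff ℝ ∞ expNegInvGlue := expNegInvGlue.contDiff
    fun_prop
  · by_cases h : x ∈ Set.Ioo (0 : ℝ) 1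
    · rw [hval x h]
      have h2 : 0 < 1 - x := by linarith [h.2]
      exact ⟨(Real.exp_pos _).le, Real.exp_le_one_iff.2
        (neg_nonpos.2 (div_nonneg (sq_nonneg _) (mul_pos h.1 h2).le))⟩
    · rw [hzero x h]
      norm_num
  -- An axis of symmetry must pass through the unique peak `1/3`, but `W` vanishes at `-1/6` and not
  -- at `5/6`.
  · by_contra! h
    have h1 := h (1 / 3 - c)
    rw [add_sub_cancel, hpeak] at h1
    have h2 := huniq _ h1.symm
    obtain rfl : c = 1 / 3 := by linarith
    have h3 := h (1 / 2)
    rw [hzero (1 / 3 - 1 / 2) (by norm_num), hval _ (by norm_num)] at h3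
    exact (Real.exp_pos _).ne' h3

/-! ### The reduction -/

section Reduction

variable {W : ℝ → ℝ} (hW : IsBellCurve W)

/-- The spacetime with metric `W_α(u) x y du² + du dv + dx² + dy²`. -/
noncomputable def pulseWave (α : BernoulliSpace) : Spacetime :=
  planeWaveSpacetime (pulseTrain W α) (contDiff_pulseTrain hW α)

/-- Over a compact set only finitely many coordinates of `α` matter: once they agree, the metrics
coincide near the set, and so do all their jets. -/
theorem continuous_pulseWave : Continuous (pulseWave hW) := by
  refine continuous_iInf_rng.2 fun n => continuous_induced_rng.2 ?_
  rw [continuous_iff_continuousAt]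
  intro α
  rw [ContinuousAt, ContinuousMap.tendsto_iff_forall_isCompact_tendstoUniformlyOn]
  intro K hK
  obtain ⟨R, hR⟩ := (hK.image (continuous_apply (0 : Fin 4))).isBounded.exists_norm_le
  -- The margin `2` leaves room for a unit neighbourhood of each point and for the floor.
  have hev : ∀ᶠ β in nhds α, ∀ m ∈ Set.Icc (-⌈R⌉ - 2) (⌈R⌉ + 2), β m = α m := by
    rw [Filter.eventually_all_finite (Set.finite_Icc _ _)]
    intro m _
    have hc : Continuous fun β : BernoulliSpace => β m :=
      continuous_apply (A := fun _ : ℤ => Bool) m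
    exact hc.continuousAt.eventually (IsOpen.mem_nhds (isOpen_discrete {α m}) rfl)
  intro U hU
  filter_upwards [hev] with β hβ x hx
  have hx0 : |x 0| ≤ R := hR _ ⟨x, hx, rfl⟩
  have hloc : (pulseWave hW β).metric =ᶠ[nhds x] (pulseWave hW α).metric := by
    have hball : ∀ᶠ y : R4 in nhds x, y 0 ∈ Set.Ioo (x 0 - 1) (x 0 + 1) :=
      (continuous_apply (0 : Fin 4)).continuousAt.eventually
        (Ioo_mem_nhds (by linarith) (by linarith))
    filter_upwards [hball] with y hy
    have hy' : β ⌊y 0⌋ = α ⌊y 0⌋ := by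
      have h1 := abs_le.1 hx0
      have h2 := Int.le_ceil R
      refine hβ _ ⟨?_, ?_⟩
      · rw [Int.le_floor]
        push_cast
        linarith [hy.1]
      · have := Int.floor_le (y 0)
        have h3 : (⌊y 0⌋ : ℝ) ≤ ((⌈R⌉ + 2 : ℤ) : ℝ) := by
          push_cast
          linarith [hy.2]
        exact_mod_cast h3
    change planeWave (pulseTrain W β) y = planeWave (pulseTrain W α) y
    have : pulseTrain W β (y 0) = pulseTrain W α (y 0) := by
      simp only [pulseTrain, hy']
    simp only [planeWave, this]
  have heq : (Spacetime.jet n (pulseWave hW β)) x = (Spacetime.jet n (pulseWave hW α)) x :=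
    (hloc.iteratedFDeriv ℝ n).eq_of_nhds
  simp only [Function.comp_apply, heq]
  exact refl_mem_uniformity hU

/-- The translation of `ℝ⁴` by `a`. -/
def translationDiffeomorph (a : R4) : Diffeomorph 𝓘(ℝ, R4) 𝓘(ℝ, R4) R4 R4 ∞ where
  toEquiv := Equiv.addRight a
  contMDiff_toFun := (contDiff_id.add contDiff_const).contMDiff
  contMDiff_invFun := (contDiff_id.add contDiff_const).contMDiff

theorem diffEquivalent_pulseWave_smul (k : Multiplicative ℤ) (α : BernoulliSpace) :
    DiffEquivalent (pulseWave hW α) (pulseWave hW (k • α)) := by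
  set a : R4 := Pi.single 0 (-(k.toAdd : ℝ)) with ha
  refine ⟨translationDiffeomorph a, fun x μ ν => ?_⟩
  have hd : ∀ μ ρ, partialDeriv μ (fun y => translationDiffeomorph a y ρ) x =
      if ρ = μ then 1 else 0 := by
    intro μ ρ
    change partialDeriv μ (fun y => y ρ + a ρ) x = _
    rw [partialDeriv_add (by fun_prop) (by fun_prop), partialDeriv_coord, partialDeriv_const,
      add_zero]
  change planeWave (pulseTrain W (k • α)) x μ ν =
    ∑ ρ, ∑ σ, _ * _ * planeWave (pulseTrain W α) (x + a) ρ σ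
  simp only [hd]
  simp [planeWave, pulseTrain_smul, ha, sub_eq_add_neg]

theorem isBorelReduction_pulseWave : IsBorelReduction (Multiplicative ℤ)
    (fun α => (⟨pulseWave hW α, planeWaveSpacetime_mem_vacuumSolutions _⟩ : vacuumSolutions)) where
  borel := ((continuous_pulseWave hW).subtype_mk _).borel_measurable
  reduces α β := by
    constructor
    · intro h
      obtain ⟨k, rfl⟩ := MulAction.orbit_eq_iff.1 h.symm
      exact diffEquivalent_pulseWave_smul hW k α
    · intro h
      obtain ⟨a, b, hab⟩ := profile_eq_of_diffEquivalent (contDiff_pulseTrain hW β)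
        (contDiff_pulseTrain hW α) (fun u => zero_lt_one.trans_le (one_le_pulseTrain hW β u))
        (fun u => zero_lt_one.trans_le (one_le_pulseTrain hW α u)) h
      exact (MulAction.orbit_eq_iff.2 (mem_orbit_of_pulseTrain_eq hW hab)).symm

end Reduction

theorem theorem3 :
    IsRich vacuumSolutions ∧
    IsGenericallyErgodic (Multiplicative ℤ) BernoulliSpace ∧
    (∃ W : ℝ → ℝ, IsBellCurve W) ∧
    ∀ W : ℝ → ℝ, IsBellCurve W →
      ∃ r : BernoulliSpace → vacuumSolutions,
        (∀ (α : BernoulliSpace) (p : R4),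
          (r α : Spacetime).metric p = planeWave (pulseTrain W α) p) ∧
        Continuous r ∧
        IsBorelReduction (Multiplicative ℤ) r := by
  refine ⟨?_, isGenericallyErgodic_bernoulliSpace, exists_isBellCurve, fun W hW =>
    ⟨fun α => ⟨pulseWave hW α, planeWaveSpacetime_mem_vacuumSolutions _⟩, fun _ _ => rfl,
      (continuous_pulseWave hW).subtype_mk _, isBorelReduction_pulseWave hW⟩⟩
  obtain ⟨W, hW⟩ := exists_isBellCurve
  exact ⟨Multiplicative ℤ, BernoulliSpace, inferInstance, inferInstance, inferInstance,
    inferInstance, isGenericallyErgodic_bernoulliSpace, _, isBorelReduction_pulseWave hW⟩
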